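/- Let $E=(E^0,E^1,r,s)$ be an arbitrary directed graph, with no restriction on the number of vertices or on the number of edges emitted by a vertex. Let $C^*(E)$ be its graph C*-algebra, that is, the universal C*-algebra generated by mutually orthogonal projections $p_v$ ($v\in E^0$) and partial isometries $s_e$ ($e\in E^1$) with mutually orthogonal ranges such that $s_e^*s_e=p_{r(e)}$ and $s_es_e^*\le p_{s(e)}$ for every edge $e$, and $p_v=\sum_{s(e)=v}s_es_e^*$ for every vertex $v$ that emits a finite non-zero number of edges. If $C^*(E)$ is a Zorn ring (every element $a$ is either nilpotent or admits an element $b$ such that $ab$ is a non-zero idempotent), then $E$ satisfies Condition (L): for every simple closed path $e_1\cdots e_n$ ($n\ge 1$, $r(e_i)=s(e_{i+1})$ for $i<n$, $r(e_n)=s(e_1)$, and $s(e_i)\ne s(e_1)$ for $i\ge 2$) there is an edge $e$ such that $s(e)=s(e_i)$ and $e\ne e_i$ for some $i$. -/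

import Mathlib

open scoped ENNReal

universe u v w

/-! ### Directed graphs and Condition (L) -/

/-- A directed graph with vertex set `V` and edge set `E`: every edge `e` has a source `src e` and a
range `rng e`.  Loops, multiple edges, infinite emitters and uncountable sets are all allowed. -/
structure DirectedGraph (V : Type u) (E : Type v) where
  src : E → V
  rng : E → V

namespace DirectedGraph

variable {V : Type u} {E : Type v} (G : DirectedGraph V E)

/-- The finite sequence of edges `μ 0, …, μ n` (of length `n + 1 ≥ 1`) is a simple closed path:
consecutive edges are composable, the last edge ends where the first one starts, and the path does
not pass through its base `src (μ 0)` again. -/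
structure IsSimpleClosedPath {n : ℕ} (μ : Fin (n + 1) → E) : Prop where
  composable : ∀ i : Fin n, G.rng (μ i.castSucc) = G.src (μ i.succ)
  closed : G.rng (μ (Fin.last n)) = G.src (μ 0)
  simple : ∀ i, i ≠ 0 → G.src (μ i) ≠ G.src (μ 0)

/-- The edge `e` is an exit for the path `μ`: it starts where some edge `μ i` of the path starts,
and it is different from `μ i`. -/
def IsExit {n : ℕ} (μ : Fin (n + 1) → E) (e : E) : Prop :=
  ∃ i, G.src e = G.src (μ i) ∧ e ≠ μ i

/-- Condition (L): every simple closed path has an exit. -/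
def ConditionL : Prop :=
  ∀ (n : ℕ) (μ : Fin (n + 1) → E), G.IsSimpleClosedPath μ → ∃ e, G.IsExit μ e

/-! ### Cuntz-Krieger families -/

/-- A Cuntz-Krieger `G`-family in a C⋆-algebra `B`: mutually orthogonal projections `p x` and
partial isometries `s e` with initial projection `s e⋆ s e = p (rng e)`, with range projection
below `p (src e)` and with mutually orthogonal ranges, such that
`p x = ∑_{src e = x} s e s e⋆` whenever `x` emits a finite non-zero number of edges. -/
structure CuntzKriegerFamily (B : Type w) [NonUnitalCStarAlgebra B] where
  p : V → B
  s : E → B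
  isStarProjection_p : ∀ x, IsStarProjection (p x)
  p_mul_p_of_ne : ∀ x y, x ≠ y → p x * p y = 0
  p_src_mul_s : ∀ e, p (G.src e) * s e = s e
  star_s_mul_s : ∀ e, star (s e) * s e = p (G.rng e)
  star_s_mul_s_of_ne : ∀ e f, e ≠ f → star (s e) * s f = 0
  p_eq_sum : ∀ (x : V) (hfin : {e | G.src e = x}.Finite), {e | G.src e = x}.Nonempty →
    p x = ∑ e ∈ hfin.toFinset, s e * star (s e)

variable {G}

theorem CuntzKriegerFamily.norm_p_le_one {B : Type w} [NonUnitalCStarAlgebra B]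
    (F : G.CuntzKriegerFamily B) (x : V) : ‖F.p x‖ ≤ 1 := by
  have h := CStarRing.norm_star_mul_self (x := F.p x)
  rw [(F.isStarProjection_p x).isSelfAdjoint.star_eq,
    (F.isStarProjection_p x).isIdempotentElem.eq] at h
  by_contra! hlt
  nlinarith

theorem CuntzKriegerFamily.norm_s_le_one {B : Type w} [NonUnitalCStarAlgebra B]
    (F : G.CuntzKriegerFamily B) (e : E) : ‖F.s e‖ ≤ 1 := by
  have h := CStarRing.norm_star_mul_self (x := F.s e)
  rw [F.star_s_mul_s] at h
  have := F.norm_p_le_one (G.rng e)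
  by_contra! hlt
  nlinarith

variable (G)

/-! ### The graph C⋆-algebra -/

/-- A C⋆-algebra together with a Cuntz-Krieger `G`-family in it.  The universe is large enough to
contain a copy of every C⋆-algebra that is generated by a Cuntz-Krieger `G`-family: such an algebra
has a dense subset of cardinality at most `κ = max (#V, #E, ℵ₀)`, hence at most `κ ^ ℵ₀` elements. -/
structure CuntzKriegerAlgebra : Type (max u v + 1) where
  carrier : Type (max u v)
  [isCStarAlgebra : NonUnitalCStarAlgebra carrier]
  family : G.CuntzKriegerFamily carrier

attribute [instance] CuntzKriegerAlgebra.isCStarAlgebra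

/-- The C⋆-algebra of bounded sections of the family of all Cuntz-Krieger `G`-families
(their `ℓ^∞` direct product, with the supremum norm). -/
abbrev CuntzKriegerProduct : Type (max u v + 1) :=
  lp (fun i : G.CuntzKriegerAlgebra => i.carrier) ∞

/-- The projection at `x` of all Cuntz-Krieger families simultaneously. -/
def productP (x : V) : G.CuntzKriegerProduct :=
  ⟨fun i => i.family.p x, memℓp_infty ⟨1, by rintro _ ⟨i, rfl⟩; exact i.family.norm_p_le_one x⟩⟩

/-- The partial isometry at `e` of all Cuntz-Krieger families simultaneously. -/
def productS (e : E) : G.CuntzKriegerProduct :=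
  ⟨fun i => i.family.s e, memℓp_infty ⟨1, by rintro _ ⟨i, rfl⟩; exact i.family.norm_s_le_one e⟩⟩

/-- The graph C⋆-algebra `C⋆(G)`, the universal C⋆-algebra generated by a Cuntz-Krieger `G`-family:
the closed `⋆`-subalgebra generated by the family `productP`, `productS`.  Thus the norm of a
`⋆`-polynomial in the generators is the supremum of its norms over all Cuntz-Krieger `G`-families.
It need not have a unit. -/
noncomputable def cstarSubalgebra : NonUnitalStarSubalgebra ℂ G.CuntzKriegerProduct :=
  (NonUnitalStarAlgebra.adjoin ℂ
    (Set.range G.productP ∪ Set.range G.productS)).topologicalClosure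

/-- The graph C⋆-algebra as a type. -/
abbrev CStar : Type (max u v + 1) := G.cstarSubalgebra

noncomputable instance : NonUnitalCStarAlgebra G.CStar :=
  NonUnitalStarSubalgebra.nonUnitalCStarAlgebra G.cstarSubalgebra
    (h_closed := NonUnitalStarSubalgebra.isClosed_topologicalClosure _)

/-- The vertex projections and edge partial isometries of `C⋆(G)`. -/
noncomputable def canonicalFamily : G.CuntzKriegerFamily G.CStar where
  p x := ⟨G.productP x, NonUnitalStarSubalgebra.le_topologicalClosure _
    (NonUnitalStarAlgebra.subset_adjoin ℂ _ (Or.inl ⟨x, rfl⟩))⟩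
  s e := ⟨G.productS e, NonUnitalStarSubalgebra.le_topologicalClosure _
    (NonUnitalStarAlgebra.subset_adjoin ℂ _ (Or.inr ⟨e, rfl⟩))⟩
  isStarProjection_p x :=
    ⟨Subtype.ext <| lp.ext <| funext fun i =>
        (i.family.isStarProjection_p x).isIdempotentElem.eq,
      Subtype.ext <| lp.ext <| funext fun i =>
        (i.family.isStarProjection_p x).isSelfAdjoint.star_eq⟩
  p_mul_p_of_ne x y h := Subtype.ext <| lp.ext <| funext fun i => i.family.p_mul_p_of_ne x y h
  p_src_mul_s e := Subtype.ext <| lp.ext <| funext fun i => i.family.p_src_mul_s e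
  star_s_mul_s e := Subtype.ext <| lp.ext <| funext fun i => i.family.star_s_mul_s e
  star_s_mul_s_of_ne e f h :=
    Subtype.ext <| lp.ext <| funext fun i => i.family.star_s_mul_s_of_ne e f h
  p_eq_sum x hfin hne := Subtype.ext <| lp.ext <| funext fun i => by
    rw [AddSubmonoidClass.coe_finsetSum, lp.coeFn_sum, Finset.sum_apply]
    exact i.family.p_eq_sum x hfin hne

/-- The universal property: every Cuntz-Krieger `G`-family in a C⋆-algebra `B` is the image of the
canonical one under exactly one `⋆`-homomorphism. -/
theorem existsUnique_lift (B : Type (max u v)) [NonUnitalCStarAlgebra B]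
    (F : G.CuntzKriegerFamily B) :
    ∃! φ : G.CStar →⋆ₙₐ[ℂ] B,
      (∀ x, φ (G.canonicalFamily.p x) = F.p x) ∧ ∀ e, φ (G.canonicalFamily.s e) = F.s e := by
  let i : G.CuntzKriegerAlgebra := ⟨B, F⟩
  let ev : G.CuntzKriegerProduct →⋆ₙₐ[ℂ] B :=
    { toFun := fun f => f i
      map_smul' := fun _ _ => rfl
      map_zero' := rfl
      map_add' := fun _ _ => rfl
      map_mul' := fun _ _ => rfl
      map_star' := fun _ => rfl }
  refine ⟨ev.comp (NonUnitalStarSubalgebraClass.subtype G.cstarSubalgebra),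
    ⟨fun _ => rfl, fun _ => rfl⟩, ?_⟩
  rintro φ ⟨hp, hs⟩
  ext ⟨a, ha⟩
  have hcont (χ : G.CStar →⋆ₙₐ[ℂ] B) : Continuous χ :=
    AddMonoidHomClass.continuous_of_bound χ 1
      (by simpa only [one_mul] using NonUnitalStarAlgHom.norm_apply_le χ)
  refine closure_minimal (s := {b : G.CStar | (b : G.CuntzKriegerProduct) ∈
      NonUnitalStarAlgebra.adjoin ℂ (Set.range G.productP ∪ Set.range G.productS)}) ?_
    (isClosed_eq (hcont φ) (hcont
      (ev.comp (NonUnitalStarSubalgebraClass.subtype G.cstarSubalgebra)))) ?_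
  · rintro ⟨b, hb⟩ (hb' : b ∈ NonUnitalStarAlgebra.adjoin ℂ _)
    change φ ⟨b, hb⟩ = b i
    have key : ∀ hb'' : b ∈ G.cstarSubalgebra, φ ⟨b, hb''⟩ = b i := by
      clear hb
      have hle := NonUnitalStarSubalgebra.le_topologicalClosure (NonUnitalStarAlgebra.adjoin ℂ
        (Set.range G.productP ∪ Set.range G.productS))
      induction hb' using NonUnitalStarAlgebra.adjoin_induction with
      | mem x hx =>
        intro _
        rcases hx with ⟨x, rfl⟩ | ⟨e, rfl⟩
        · exact hp x
        · exact hs e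
      | add x y hx hy ihx ihy =>
        intro _
        exact (map_add φ ⟨x, hle hx⟩ ⟨y, hle hy⟩).trans (congrArg₂ _ (ihx _) (ihy _))
      | zero => intro _; exact map_zero φ
      | mul x y hx hy ihx ihy =>
        intro _
        exact (map_mul φ ⟨x, hle hx⟩ ⟨y, hle hy⟩).trans (congrArg₂ _ (ihx _) (ihy _))
      | smul r x hx ihx =>
        intro _
        exact (map_smul φ r ⟨x, hle hx⟩).trans (congrArg _ (ihx _))
      | star x hx ihx =>
        intro _
        exact (map_star φ ⟨x, hle hx⟩).trans (congrArg _ (ihx _))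
    exact key hb
  · rw [closure_subtype]
    refine closure_mono (fun b hb => ?_) ha
    exact ⟨⟨b, NonUnitalStarSubalgebra.le_topologicalClosure _ hb⟩, hb, rfl⟩

end DirectedGraph

/-! ### Zorn rings -/

/-- The power `a ^ (n + 1)` in a ring that need not have a unit. -/
def succPow {R : Type w} [NonUnitalRing R] (a : R) : ℕ → R
  | 0 => a
  | n + 1 => succPow a n * a

/-- A (not necessarily unital) ring is a Zorn ring if for every element `a`, either `a` is nilpotent
or there is an element `b` such that `a * b` is a non-zero idempotent. -/
def IsZornRing (R : Type w) [NonUnitalRing R] : Prop :=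
  ∀ a : R, (∃ n, succPow a n = 0) ∨ ∃ b : R, IsIdempotentElem (a * b) ∧ a * b ≠ 0

/-! Suppose a simple closed path of length N has no exit; let p be the projection at its base and u
the product of its edge isometries. The relations make u a unitary of the corner p C⋆(G) p, and
every word in the generators, compressed by p, collapses to a power of u or u⋆, or to zero. So the
corner is a copy of the continuous functions on the circle, in which a = u - p is w ↦ w - 1: not
nilpotent, yet zero at w = 1. If ab is idempotent, it compresses to a continuous {0,1}-valued
function vanishing at 1, which is zero because the circle is connected; this forces ab = 0.

Instead of an isomorphism, the proof uses functionals φ_z: vector states at the periodic path on ℓ²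
of the infinite paths, with edge operators scaled by z. They are multiplicative on the corner
because p acts there with rank one (`pathFamily_p_apply`), and they send u to z^N. The generated
⋆-algebra compresses to functions of u (`isCycleFunction_corner`), whose quasispectrum lies in the
circle and 0. By density the φ_z control the norm of the corner (`norm_corner_le`) and vary
continuously with z (`continuous_cornerCharacter`). `not_isZornRing` then runs the argument above.
-/

/-! ### Operators on `ℓ²` induced by partial bijections -/

namespace PEquiv

variable {X : Type w}

/-- Injectivity of `σ` makes the nonzero terms distinct coordinates of `g`. This gives both square
summability and the norm bound for `compOp`. -/
theorem sum_norm_elim_rpow_le (σ : X ≃. X) (g : lp (fun _ : X => ℂ) 2) (t : Finset X) :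
    ∑ x ∈ t, ‖(σ x).elim 0 g‖ ^ (2 : ℝ≥0∞).toReal ≤ ‖g‖ ^ (2 : ℝ≥0∞).toReal := by
  classical
  refine le_trans ?_ (lp.sum_rpow_le_norm_rpow (by norm_num) g
    (t.filterMap σ fun a a' b hb hb' => σ.inj hb hb'))
  rw [← Finset.sum_filter_of_ne (p := fun x => (σ x).isSome)]
  · refine le_of_eq (Finset.sum_bij (fun x hx => (σ x).get (Finset.mem_filter.1 hx).2) ?_ ?_ ?_ ?_)
    · intro x hx
      simp only [Finset.mem_filterMap]
      exact ⟨x, (Finset.mem_filter.1 hx).1, by simp⟩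
    · intro x hx y hy hxy
      refine σ.inj (b := (σ x).get (Finset.mem_filter.1 hx).2) (Option.get_mem _) ?_
      rw [hxy]
      exact Option.get_mem _
    · intro y hy
      obtain ⟨x, hx, hxy⟩ := Finset.mem_filterMap _ |>.1 hy
      exact ⟨x, Finset.mem_filter.2 ⟨hx, by simp [hxy]⟩, by simp [hxy]⟩
    · intro x hx
      obtain ⟨y, hy⟩ := Option.isSome_iff_exists.1 (Finset.mem_filter.1 hx).2
      simp [hy]
  · intro x _ hx
    cases h : σ x with
    | none => simp [h] at hx
    | some y => rfl

/-- The partial isometry `g ↦ g ∘ σ` of `ℓ²(X)` given by a partial bijection `σ` of `X`. -/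
noncomputable def compOp (σ : X ≃. X) :
    lp (fun _ : X => ℂ) 2 →L[ℂ] lp (fun _ : X => ℂ) 2 :=
  LinearMap.mkContinuous
    { toFun := fun g => ⟨fun x => (σ x).elim 0 g, memℓp_gen' (σ.sum_norm_elim_rpow_le g)⟩
      map_add' := fun f g => lp.ext <| funext fun x => by
        change (σ x).elim 0 _ = (σ x).elim 0 f + (σ x).elim 0 g
        cases σ x
        · exact (add_zero 0).symm
        · rfl
      map_smul' := fun c g => lp.ext <| funext fun x => by
        change (σ x).elim 0 _ = c • (σ x).elim 0 g
        cases σ x <;> simp } 1 fun g => by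
    rw [one_mul]
    exact lp.norm_le_of_forall_sum_le (by norm_num) (norm_nonneg _) (σ.sum_norm_elim_rpow_le g)

@[simp]
theorem compOp_apply (σ : X ≃. X) (g : lp (fun _ : X => ℂ) 2) (x : X) :
    σ.compOp g x = (σ x).elim 0 g := rfl

theorem compOp_single [DecidableEq X] (σ : X ≃. X) {x y : X} (h : σ x = some y) (a : ℂ) :
    σ.compOp (lp.single 2 y a) = lp.single 2 x a := by
  ext x'
  rw [compOp_apply, lp.single_apply]
  by_cases hx : x' = x
  · subst hx
    simp [h]
  · rw [Pi.single_eq_of_ne hx]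
    cases h' : σ x' with
    | none => rfl
    | some y' =>
      have : y' ≠ y := by
        rintro rfl
        exact hx (σ.inj h' h)
      simp [this]

theorem compOp_single_of_symm_eq_none [DecidableEq X] (σ : X ≃. X) {y : X} (h : σ.symm y = none)
    (a : ℂ) : σ.compOp (lp.single 2 y a) = 0 := by
  ext x
  rw [compOp_apply]
  cases h' : σ x with
  | none => rfl
  | some y' =>
    have : y' ≠ y := by
      rintro rfl
      rw [← σ.eq_some_iff] at h'
      simp [h] at h'
    simp [this]

theorem star_compOp (σ : X ≃. X) : star σ.compOp = σ.symm.compOp := by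
  classical
  ext g y
  have h : star σ.compOp g y = inner ℂ (σ.compOp (lp.single 2 y 1)) g := by
    rw [← ContinuousLinearMap.adjoint_inner_right, lp.inner_single_left]
    simp [ContinuousLinearMap.star_eq_adjoint]
  rw [h, compOp_apply]
  cases h' : σ.symm y with
  | none => simp [σ.compOp_single_of_symm_eq_none h']
  | some x =>
    rw [σ.compOp_single (σ.eq_some_iff.1 h'), lp.inner_single_left]
    simp

end PEquiv

/-! ### The Cuntz-Krieger family on the infinite paths -/

namespace DirectedGraph

variable {V : Type u} {E : Type v} (G : DirectedGraph V E)

/-- Infinite paths of the graph. -/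
@[ext]
structure InfinitePath : Type (max u v) where
  edge : ℕ → E
  composable : ∀ k, G.rng (edge k) = G.src (edge (k + 1))

variable {G}

namespace InfinitePath

/-- The path without its first edge. -/
def tail (x : G.InfinitePath) : G.InfinitePath := ⟨fun k => x.edge (k + 1), fun _ => x.composable _⟩

/-- The path with one more edge in front. -/
def cons (e : E) (x : G.InfinitePath) (h : G.rng e = G.src (x.edge 0)) :
    G.InfinitePath where
  edge k := Nat.casesOn k e x.edge
  composable := by
    rintro (_ | k)
    · exact h
    · exact x.composable k

theorem cons_tail (x : G.InfinitePath) : cons (x.edge 0) x.tail (x.composable 0) = x := by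
  ext k
  cases k <;> rfl

open Classical in
/-- The partial bijection which removes the first edge if this edge is `e`. -/
noncomputable def uncons (e : E) : G.InfinitePath ≃. G.InfinitePath where
  toFun x := if x.edge 0 = e then some x.tail else none
  invFun x := if h : G.rng e = G.src (x.edge 0) then some (cons e x h) else none
  inv x y := by
    constructor
    · intro h
      split_ifs at h with h'
      · obtain rfl := Option.some.inj h
        exact if_pos rfl
    · intro h
      split_ifs at h with h'
      · subst h'
        obtain rfl := Option.some.inj h
        exact (dif_pos (x.composable 0)).trans (congrArg some x.cons_tail)

open Classical in
theorem uncons_apply (e : E) (x : G.InfinitePath) :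
    uncons e x = if x.edge 0 = e then some x.tail else none := rfl

open Classical in
theorem uncons_symm_apply (e : E) (x : G.InfinitePath) : (uncons e).symm x =
    if h : G.rng e = G.src (x.edge 0) then some (cons e x h) else none := rfl

open Classical in
/-- The partial identity on the paths that start at `a`. -/
noncomputable def startingAt (a : V) : G.InfinitePath ≃. G.InfinitePath :=
  PEquiv.ofSet {x | G.src (x.edge 0) = a}

open Classical in
theorem startingAt_apply (a : V) (x : G.InfinitePath) :
    startingAt a x = if G.src (x.edge 0) = a then some x else none := rfl

theorem startingAt_symm (a : V) : (startingAt a : G.InfinitePath ≃. G.InfinitePath).symm =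
    startingAt a := by
  classical
  exact PEquiv.ofSet_symm _

end InfinitePath

variable (G)

open InfinitePath in
/-- The Cuntz-Krieger family of creation operators on `ℓ²` of the infinite paths, with the edge
operators multiplied by `z`. -/
noncomputable def pathFamily (z : Circle) : G.CuntzKriegerFamily
    (lp (fun _ : G.InfinitePath => ℂ) 2 →L[ℂ] lp (fun _ : G.InfinitePath => ℂ) 2) where
  p a := (startingAt a).compOp
  s e := (z : ℂ) • (uncons e).compOp
  isStarProjection_p a := by
    refine ⟨?_, ?_⟩
    · ext g x
      by_cases h : G.src (x.edge 0) = a <;> simp [startingAt_apply, h]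
    · rw [IsSelfAdjoint, PEquiv.star_compOp, startingAt_symm]
  p_mul_p_of_ne a b hab := by
    ext g x
    by_cases h : G.src (x.edge 0) = a
    · have : G.src (x.edge 0) ≠ b := h ▸ hab
      simp [startingAt_apply, h, hab]
    · simp [startingAt_apply, h]
  p_src_mul_s e := by
    ext g x
    by_cases h : x.edge 0 = e
    · simp [startingAt_apply, uncons_apply, h]
    · by_cases h' : G.src (x.edge 0) = G.src e <;> simp [startingAt_apply, uncons_apply, h, h']
  star_s_mul_s e := by
    rw [star_smul, smul_mul_smul_comm, PEquiv.star_compOp]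
    have : star (z : ℂ) * z = 1 := by
      rw [mul_comm]
      simpa using Complex.mul_conj z
    rw [this, one_smul]
    ext g x
    by_cases h : G.rng e = G.src (x.edge 0)
    · simp [startingAt_apply, uncons_symm_apply, h, uncons_apply, cons, tail]
    · simp [startingAt_apply, uncons_symm_apply, h, Ne.symm h]
  star_s_mul_s_of_ne e f hef := by
    rw [star_smul, smul_mul_smul_comm, PEquiv.star_compOp]
    convert smul_zero _
    ext g x
    by_cases h : G.rng e = G.src (x.edge 0)
    · simp [uncons_symm_apply, h, uncons_apply, cons, hef]
    · simp [uncons_symm_apply, h]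
  p_eq_sum a hfin _ := by
    classical
    have (e : E) : ((z : ℂ) • (uncons e).compOp) * star ((z : ℂ) • (uncons e).compOp) =
        (uncons e).compOp * (uncons e : G.InfinitePath ≃. G.InfinitePath).symm.compOp := by
      rw [star_smul, smul_mul_smul_comm, PEquiv.star_compOp]
      have : (z : ℂ) * star (z : ℂ) = 1 := by
        simpa using Complex.mul_conj z
      rw [this, one_smul]
    simp_rw [this]
    ext g x
    -- Each s e s e⋆ projects onto the paths with first edge `e`; every path starting at `a` has
    -- exactly one first edge, so these projections sum to `p a`.
    have key (e : E) : ((uncons e).compOp *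
        (uncons e : G.InfinitePath ≃. G.InfinitePath).symm.compOp : lp (fun _ : G.InfinitePath => ℂ) 2 →L[ℂ]
          lp (fun _ : G.InfinitePath => ℂ) 2) g x =
        if x.edge 0 = e then g x else 0 := by
      by_cases h : x.edge 0 = e
      · have h' : (uncons e).symm x.tail = some x :=
          (uncons e).eq_some_iff.2 (by simp [uncons_apply, h])
        simp [uncons_apply, h, h']
      · simp [uncons_apply, h]
    rw [_root_.sum_apply, lp.coeFn_sum, Finset.sum_apply, Finset.sum_congr rfl
      fun e _ => key e, Finset.sum_ite_eq]
    by_cases h : G.src (x.edge 0) = a <;> simp [startingAt_apply, h]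

end DirectedGraph

/-! ### The corner at a cycle without exit -/

namespace DirectedGraph

variable {V : Type u} {E : Type v} (G : DirectedGraph V E)

/-- The periodic sequence `m` of edges runs through a cycle without exit, of length `N`. -/
structure IsExitlessCycle (m : ℕ → E) (N : ℕ) : Prop where
  pos : 0 < N
  composable : ∀ k, G.rng (m k) = G.src (m (k + 1))
  periodic : ∀ k, m (k + N) = m k
  exitless : ∀ k e, G.src e = G.src (m k) → e = m k
  dvd_sub : ∀ i j, i ≤ j → G.src (m i) = G.src (m j) → N ∣ j - i

variable {G}

namespace CuntzKriegerFamily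

variable {A : Type w} [NonUnitalCStarAlgebra A] (F : G.CuntzKriegerFamily A)

theorem p_mul_self (a : V) : F.p a * F.p a = F.p a := (F.isStarProjection_p a).isIdempotentElem.eq

theorem star_p (a : V) : star (F.p a) = F.p a := (F.isStarProjection_p a).isSelfAdjoint.star_eq

theorem p_mul_s_eq_zero {a : V} {e : E} (h : G.src e ≠ a) : F.p a * F.s e = 0 := by
  rw [← F.p_src_mul_s, ← mul_assoc, F.p_mul_p_of_ne _ _ h.symm, zero_mul]

/-- The product `p (src (m 0)) * s (m 0) * ⋯ * s (m (k - 1))`. -/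
def pathProd (m : ℕ → E) : ℕ → A
  | 0 => F.p (G.src (m 0))
  | k + 1 => pathProd m k * F.s (m k)

variable {m : ℕ → E} {N : ℕ} (hm : G.IsExitlessCycle m N)

theorem pathProd_succ (k : ℕ) : F.pathProd m (k + 1) = F.pathProd m k * F.s (m k) := rfl

theorem p_mul_pathProd (k : ℕ) : F.p (G.src (m 0)) * F.pathProd m k = F.pathProd m k := by
  induction k with
  | zero => exact F.p_mul_self _
  | succ k ih => rw [pathProd_succ, ← mul_assoc, ih]

include hm

/-- Absence of exits leaves a single term in the Cuntz-Krieger sum; this is what makes the cycle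
unitary in its corner. -/
theorem s_mul_star_s (k : ℕ) : F.s (m k) * star (F.s (m k)) = F.p (G.src (m k)) := by
  have hs : {e | G.src e = G.src (m k)} = {m k} :=
    Set.eq_singleton_iff_unique_mem.2 ⟨rfl, fun e he => hm.exitless k e he⟩
  have hfin : {e | G.src e = G.src (m k)}.Finite := hs ▸ Set.finite_singleton _
  have : hfin.toFinset = {m k} := by
    ext e
    simp [hs]
  rw [F.p_eq_sum _ hfin ⟨m k, rfl⟩, this, Finset.sum_singleton]

theorem s_mul_p_rng (k : ℕ) : F.s (m k) * F.p (G.rng (m k)) = F.s (m k) := by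
  rw [← F.star_s_mul_s, ← mul_assoc, F.s_mul_star_s hm, F.p_src_mul_s]

theorem pathProd_mul_p (k : ℕ) : F.pathProd m k * F.p (G.src (m k)) = F.pathProd m k := by
  cases k with
  | zero => exact F.p_mul_self _
  | succ k => rw [pathProd_succ, mul_assoc, ← hm.composable, F.s_mul_p_rng hm]

theorem pathProd_mul_p_of_ne {k : ℕ} {a : V} (h : G.src (m k) ≠ a) :
    F.pathProd m k * F.p a = 0 := by
  rw [← F.pathProd_mul_p hm, mul_assoc, F.p_mul_p_of_ne _ _ h, mul_zero]

theorem pathProd_mul_s_of_ne {k : ℕ} {e : E} (h : e ≠ m k) : F.pathProd m k * F.s e = 0 := by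
  rw [← F.p_src_mul_s, ← mul_assoc,
    F.pathProd_mul_p_of_ne hm fun h' => h (hm.exitless k e h'.symm), zero_mul]

theorem pathProd_mul_star (k : ℕ) :
    F.pathProd m k * star (F.pathProd m k) = F.p (G.src (m 0)) := by
  induction k with
  | zero => rw [pathProd, F.star_p, F.p_mul_self]
  | succ k ih =>
    rw [pathProd_succ, star_mul, mul_assoc, ← mul_assoc (F.s _), F.s_mul_star_s hm, ← mul_assoc,
      F.pathProd_mul_p hm, ih]

theorem star_pathProd_mul (k : ℕ) :
    star (F.pathProd m k) * F.pathProd m k = F.p (G.src (m k)) := by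
  induction k with
  | zero => rw [pathProd, F.star_p, F.p_mul_self]
  | succ k ih =>
    rw [pathProd_succ, star_mul, mul_assoc, ← mul_assoc (star (F.pathProd m k)), ih, F.p_src_mul_s,
      F.star_s_mul_s, hm.composable]

theorem pathProd_add (k : ℕ) :
    F.pathProd m (k + N) = F.pathProd m N * F.pathProd m k := by
  induction k with
  | zero =>
    have h := hm.periodic 0
    rw [zero_add] at h ⊢
    rw [pathProd, ← h, F.pathProd_mul_p hm]
  | succ k ih => rw [add_right_comm, pathProd_succ, hm.periodic, ih, pathProd_succ, mul_assoc]

theorem pathProd_mul_p_zero : F.pathProd m N * F.p (G.src (m 0)) = F.pathProd m N := by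
  have := F.pathProd_add hm 0
  rwa [zero_add, eq_comm] at this

theorem src_period : G.src (m N) = G.src (m 0) := by
  have h := hm.periodic 0
  rw [zero_add] at h
  rw [h]

/-- Normality opens the continuous functional calculus for the cycle. -/
theorem isStarNormal_pathProd : IsStarNormal (F.pathProd m N) where
  star_comm_self := by
    rw [Commute, SemiconjBy, F.star_pathProd_mul hm, F.pathProd_mul_star hm,
      src_period hm]

end CuntzKriegerFamily

end DirectedGraph

/-! ### Functions of the cycle and characters of the corner -/

namespace DirectedGraph

variable {V : Type u} {E : Type v} {G : DirectedGraph V E}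

namespace CuntzKriegerFamily

variable {A : Type w} [NonUnitalCStarAlgebra A] (F : G.CuntzKriegerFamily A)
variable {m : ℕ → E} {N : ℕ} (hm : G.IsExitlessCycle m N)

/-- The identity u u u⋆ = u becomes l |l|² = l on the quasispectrum. The value 0 belongs to it and
must be excluded. -/
theorem norm_eq_one_of_mem_quasispectrum (hm : G.IsExitlessCycle m N) {l : ℂ}
    (hl : l ∈ quasispectrum ℂ (F.pathProd m N)) (h0 : l ≠ 0) : ‖l‖ = 1 := by
  set u := F.pathProd m N with hu
  have hn : IsStarNormal u := F.isStarNormal_pathProd hm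
  have h1 : cfcₙ (fun z : ℂ => z * star z) u = F.p (G.src (m 0)) := by
    rw [cfcₙ_mul (fun z : ℂ => z) (fun z : ℂ => star z) u, cfcₙ_id' ℂ u, cfcₙ_star, cfcₙ_id' ℂ u,
      F.pathProd_mul_star hm]
  have h2 : cfcₙ (fun z : ℂ => z * (z * star z)) u = cfcₙ (fun z : ℂ => z) u := by
    rw [cfcₙ_mul (fun z : ℂ => z) (fun z : ℂ => z * star z) u, h1, cfcₙ_id' ℂ u, hu,
      F.pathProd_mul_p_zero hm]
  have h3 := (cfcₙ_eq_cfcₙ_iff_eqOn (a := u) (f := fun z : ℂ => z * (z * star z))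
    (g := fun z : ℂ => z)).1 h2 hl
  have h4 : l * star l = 1 := mul_left_cancel₀ h0 (by simpa using h3)
  have h5 : ‖l‖ * ‖l‖ = 1 := by
    rw [← CStarRing.norm_self_mul_star, h4, norm_one]
  nlinarith [norm_nonneg l]

/-- A family of functionals, indexed by the circle, that are multiplicative on the corner at the
base of the cycle `m`. -/
structure CornerCharacters (m : ℕ → E) (N : ℕ) where
  φ : Circle → A →ₗ[ℂ] ℂ
  norm_le : ∀ z x, ‖φ z x‖ ≤ ‖x‖
  map_mul : ∀ z x y, φ z (x * F.p (G.src (m 0)) * y) = φ z x * φ z y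
  map_star : ∀ z x, φ z (star x) = star (φ z x)
  map_p : ∀ z, φ z (F.p (G.src (m 0))) = 1
  map_pathProd : ∀ z, φ z (F.pathProd m N) = (z : ℂ) ^ N

variable {F}
variable (χ : F.CornerCharacters m N)

theorem CornerCharacters.map_corner (z : Circle) (x : A) :
    χ.φ z (F.p (G.src (m 0)) * x * F.p (G.src (m 0))) = χ.φ z x := by
  have h : F.p (G.src (m 0)) * x * F.p (G.src (m 0)) = F.p (G.src (m 0)) * F.p (G.src (m 0)) *
      (x * F.p (G.src (m 0)) * F.p (G.src (m 0))) := by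
    rw [F.p_mul_self, mul_assoc x, F.p_mul_self, mul_assoc]
  rw [h, χ.map_mul, χ.map_mul, χ.map_p, one_mul, mul_one]

/-- Elements of the corner that are continuous functions of the cycle. -/
structure IsCycleFunction (χ : F.CornerCharacters m N) (y : A) : Prop where
  p_mul : F.p (G.src (m 0)) * y = y
  mul_p : y * F.p (G.src (m 0)) = y
  exists_cfc : ∃ f : ℂ → ℂ, Continuous f ∧ f 0 = 0 ∧ cfcₙ f (F.pathProd m N) = y ∧
    ∀ z : Circle, χ.φ z y = f ((z : ℂ) ^ N)

namespace IsCycleFunction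

variable {χ} {y y' : A}

theorem zero : IsCycleFunction χ 0 :=
  ⟨mul_zero _, zero_mul _, 0, continuous_const, rfl, cfcₙ_zero ℂ _, fun _ => _root_.map_zero _⟩

theorem star (hy : IsCycleFunction χ y) : IsCycleFunction χ (star y) := by
  obtain ⟨f, hf, hf0, hfy, hfz⟩ := hy.exists_cfc
  refine ⟨?_, ?_, fun z => Star.star (f z), by fun_prop, by simp [hf0], ?_, fun z => ?_⟩
  · have := congrArg Star.star hy.mul_p
    rwa [star_mul, F.star_p] at this
  · have := congrArg Star.star hy.p_mul
    rwa [star_mul, F.star_p] at this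
  · rw [cfcₙ_star, hfy]
  · rw [χ.map_star, hfz]

theorem add (hy : IsCycleFunction χ y) (hy' : IsCycleFunction χ y') :
    IsCycleFunction χ (y + y') := by
  obtain ⟨f, hf, hf0, hfy, hfz⟩ := hy.exists_cfc
  obtain ⟨g, hg, hg0, hgy, hgz⟩ := hy'.exists_cfc
  refine ⟨by rw [mul_add, hy.p_mul, hy'.p_mul], by rw [add_mul, hy.mul_p, hy'.mul_p],
    fun z => f z + g z, by fun_prop, by simp [hf0, hg0], ?_, fun z => ?_⟩
  · rw [cfcₙ_add f g _ hf.continuousOn hf0 hg.continuousOn hg0, hfy, hgy]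
  · rw [map_add, hfz, hgz]

theorem smul (c : ℂ) (hy : IsCycleFunction χ y) : IsCycleFunction χ (c • y) := by
  obtain ⟨f, hf, hf0, hfy, hfz⟩ := hy.exists_cfc
  refine ⟨by rw [mul_smul_comm, hy.p_mul], by rw [smul_mul_assoc, hy.mul_p],
    fun z => c * f z, by fun_prop, by simp [hf0], ?_, fun z => ?_⟩
  · rw [cfcₙ_const_mul c f _ hf.continuousOn hf0, hfy]
  · rw [map_smul, hfz, smul_eq_mul]

theorem mul (hy : IsCycleFunction χ y) (hy' : IsCycleFunction χ y') :
    IsCycleFunction χ (y * y') := by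
  obtain ⟨f, hf, hf0, hfy, hfz⟩ := hy.exists_cfc
  obtain ⟨g, hg, hg0, hgy, hgz⟩ := hy'.exists_cfc
  refine ⟨by rw [← mul_assoc, hy.p_mul], by rw [mul_assoc, hy'.mul_p],
    fun z => f z * g z, by fun_prop, by simp [hf0], ?_, fun z => ?_⟩
  · rw [cfcₙ_mul f g _ hf.continuousOn hf0 hg.continuousOn hg0, hfy, hgy]
  · nth_rewrite 1 [← hy.mul_p]
    rw [χ.map_mul, hfz, hgz]

include hm

theorem pathProd : IsCycleFunction χ (F.pathProd m N) :=
  have := F.isStarNormal_pathProd hm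
  ⟨F.p_mul_pathProd N, F.pathProd_mul_p_zero hm, id, continuous_id, rfl, cfcₙ_id ℂ _,
    χ.map_pathProd⟩

/-- The constant 1 does not vanish at 0, so p is obtained as u u⋆, from the function |w|². -/
theorem p : IsCycleFunction χ (F.p (G.src (m 0))) := by
  rw [← F.pathProd_mul_star hm N]
  exact (pathProd hm).mul (pathProd hm).star

theorem pathProd_add_mul_star (j k : ℕ) :
    IsCycleFunction χ (F.pathProd m (j + k * N) * Star.star (F.pathProd m j)) := by
  induction k with
  | zero =>
    rw [zero_mul, add_zero, F.pathProd_mul_star hm]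
    exact p hm
  | succ k ih =>
    rw [add_mul, one_mul, ← add_assoc, F.pathProd_add hm, mul_assoc]
    exact (pathProd hm).mul ih

/-- The product vanishes unless the two paths end at the same vertex; then their lengths differ by a
multiple of `N`, and whole turns of the cycle remain. -/
theorem pathProd_mul_star (i j : ℕ) :
    IsCycleFunction χ (F.pathProd m i * Star.star (F.pathProd m j)) := by
  wlog hij : j ≤ i generalizing i j
  · have := (this j i (by omega)).star
    rwa [star_mul, star_star] at this
  by_cases h : G.src (m j) = G.src (m i)
  · obtain ⟨k, hk⟩ := hm.dvd_sub j i hij h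
    obtain rfl : i = j + k * N := by
      rw [mul_comm, ← hk]
      omega
    exact pathProd_add_mul_star hm j k
  · rw [← F.pathProd_mul_p hm j, star_mul, F.star_p, ← mul_assoc,
      F.pathProd_mul_p_of_ne hm (Ne.symm h), zero_mul]
    exact zero

theorem norm_le (hy : IsCycleFunction χ y) {C : ℝ} (hC : ∀ z, ‖χ.φ z y‖ ≤ C) : ‖y‖ ≤ C := by
  obtain ⟨f, hf, hf0, hfy, hfz⟩ := hy.exists_cfc
  have hC0 : 0 ≤ C := (norm_nonneg _).trans (hC 1)
  rw [← hfy]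
  refine norm_cfcₙ_le fun l hl => ?_
  rcases eq_or_ne l 0 with rfl | h0
  · simpa [hf0] using hC0
  have h1 := F.norm_eq_one_of_mem_quasispectrum hm hl h0
  have hN : (N : ℂ) ≠ 0 := by exact_mod_cast hm.pos.ne'
  obtain ⟨z, hz⟩ : ∃ z : Circle, (z : ℂ) ^ N = l := by
    -- An N-th root of `l`, needed because φ_z sees only z^N.
    refine ⟨Circle.exp (l.arg / N), ?_⟩
    rw [Circle.coe_exp, ← Complex.exp_nat_mul]
    conv_rhs => rw [← Complex.norm_mul_exp_arg_mul_I l, h1]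
    push_cast
    rw [one_mul]
    congr 1
    field_simp
  rw [← hz, ← hfz]
  exact hC z

end IsCycleFunction

/-! ### Reduction of words in the generators -/

/-- The elements `t * star (s e₁) * ⋯ * star (s eₙ)` with `t = pathProd m k`. -/
inductive IsCycleWord (F : G.CuntzKriegerFamily A) (m : ℕ → E) : A → Prop
  | pathProd (k : ℕ) : IsCycleWord F m (F.pathProd m k)
  | mul_star (y : A) (e : E) : IsCycleWord F m y → IsCycleWord F m (y * star (F.s e))

include hm in
theorem IsCycleWord.mul_p {y : A} (hy : IsCycleWord F m y) (a : V) :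
    y * F.p a = y ∨ y * F.p a = 0 := by
  cases hy with
  | pathProd k =>
    by_cases h : G.src (m k) = a
    · exact Or.inl (h ▸ F.pathProd_mul_p hm k)
    · exact Or.inr (F.pathProd_mul_p_of_ne hm h)
  | mul_star y e hy =>
    rw [mul_assoc, ← F.star_p a, ← star_mul]
    by_cases h : G.src e = a
    · rw [← h, F.p_src_mul_s]
      exact Or.inl rfl
    · rw [F.p_mul_s_eq_zero h, star_zero, mul_zero]
      exact Or.inr rfl

include hm in
-- Without exits, a path along the cycle can only be continued by its next edge; after an adjoint
-- edge, the new edge either cancels it or gives zero.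
theorem IsCycleWord.mul_s {y : A} (hy : IsCycleWord F m y) (e : E) :
    IsCycleWord F m (y * F.s e) ∨ y * F.s e = 0 := by
  classical
  cases hy with
  | pathProd k =>
    by_cases h : e = m k
    · subst h
      exact Or.inl (.pathProd (k + 1))
    · exact Or.inr (F.pathProd_mul_s_of_ne hm h)
  | mul_star y f hy =>
    rw [mul_assoc]
    by_cases h : f = e
    · subst h
      rw [F.star_s_mul_s]
      refine (hy.mul_p hm (G.rng f)).imp_left fun h => ?_
      rwa [h]
    · rw [F.star_s_mul_s_of_ne _ _ h, mul_zero]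
      exact Or.inr rfl

include hm in
-- Adjoint edges are peeled off the word and absorbed into the adjoint path on the right, whose
-- length `j` grows by one each time.
theorem IsCycleWord.isCycleFunction {y : A} (hy : IsCycleWord F m y) (j : ℕ) :
    IsCycleFunction χ (y * star (F.pathProd m j)) := by
  induction hy generalizing j with
  | pathProd k => exact .pathProd_mul_star hm k j
  | mul_star y e hy ih =>
    rw [mul_assoc, ← star_mul]
    by_cases h : e = m j
    · subst h
      exact ih (j + 1)
    · rw [F.pathProd_mul_s_of_ne hm h, star_zero, mul_zero]
      exact .zero

include hm in
theorem mul_mem_span_isCycleWord {x : A}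
    (hx : x ∈ NonUnitalStarAlgebra.adjoin ℂ (Set.range F.p ∪ Set.range F.s)) :
    ∀ y ∈ Submodule.span ℂ {y | IsCycleWord F m y},
      y * x ∈ Submodule.span ℂ {y | IsCycleWord F m y} ∧
      y * star x ∈ Submodule.span ℂ {y | IsCycleWord F m y} := by
  -- By linearity it suffices to multiply single words. The claim covers `x` and `star x` together
  -- so that the star case of the induction merely swaps them.
  have key (x : A) (h : ∀ y, IsCycleWord F m y →
      y * x ∈ Submodule.span ℂ {y | IsCycleWord F m y}) :
      ∀ y ∈ Submodule.span ℂ {y | IsCycleWord F m y},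
        y * x ∈ Submodule.span ℂ {y | IsCycleWord F m y} := by
    intro y hy
    induction hy using Submodule.span_induction with
    | mem y hy => exact h y hy
    | zero => rw [zero_mul]; exact zero_mem _
    | add y y' _ _ ih ih' => rw [add_mul]; exact add_mem ih ih'
    | smul c y _ ih => rw [smul_mul_assoc]; exact Submodule.smul_mem _ _ ih
  induction hx using NonUnitalStarAlgebra.adjoin_induction with
  | mem x hx =>
    intro y hy
    rcases hx with ⟨a, rfl⟩ | ⟨e, rfl⟩
    · rw [F.star_p, and_self]
      refine key _ (fun y hy => ?_) y hy
      rcases hy.mul_p hm a with h | h <;> rw [h]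
      exacts [Submodule.subset_span hy, zero_mem _]
    · refine ⟨key _ (fun y hy => ?_) y hy, key _ (fun y hy => ?_) y hy⟩
      · rcases hy.mul_s hm e with h | h
        · exact Submodule.subset_span h
        · rw [h]
          exact zero_mem _
      · exact Submodule.subset_span (.mul_star y e hy)
  | zero => exact fun y _ => by simp
  | add x x' _ _ ih ih' =>
    intro y hy
    rw [star_add, mul_add, mul_add]
    exact ⟨add_mem (ih y hy).1 (ih' y hy).1, add_mem (ih y hy).2 (ih' y hy).2⟩
  | mul x x' _ _ ih ih' =>
    intro y hy
    rw [star_mul, ← mul_assoc, ← mul_assoc]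
    exact ⟨(ih' _ (ih y hy).1).1, (ih _ (ih' y hy).2).2⟩
  | smul c x _ ih =>
    intro y hy
    rw [star_smul, mul_smul_comm, mul_smul_comm]
    exact ⟨Submodule.smul_mem _ _ (ih y hy).1, Submodule.smul_mem _ _ (ih y hy).2⟩
  | star x _ ih =>
    intro y hy
    rw [star_star]
    exact (ih y hy).symm

include hm in
theorem isCycleFunction_corner {x : A}
    (hx : x ∈ NonUnitalStarAlgebra.adjoin ℂ (Set.range F.p ∪ Set.range F.s)) :
    IsCycleFunction χ (F.p (G.src (m 0)) * x * F.p (G.src (m 0))) := by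
  have h := (mul_mem_span_isCycleWord hm hx (F.p (G.src (m 0)))
    (Submodule.subset_span (.pathProd 0))).1
  generalize F.p (G.src (m 0)) * x = y at h
  induction h using Submodule.span_induction with
  | mem y hy =>
    have := hy.isCycleFunction hm χ 0
    rwa [CuntzKriegerFamily.pathProd, F.star_p] at this
  | zero => rw [zero_mul]; exact .zero
  | add y y' _ _ ih ih' => rw [add_mul]; exact ih.add ih'
  | smul c y _ ih => rw [smul_mul_assoc]; exact ih.smul c

/-! ### From the dense subalgebra to the whole algebra -/

/-- Density of the `⋆`-algebra generated by the family. -/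
def Generates (F : G.CuntzKriegerFamily A) : Prop :=
  Dense (NonUnitalStarAlgebra.adjoin ℂ (Set.range F.p ∪ Set.range F.s) : Set A)

include hm in
theorem norm_corner_le (hF : F.Generates) {x : A} {C : ℝ} (hC : ∀ z, ‖χ.φ z x‖ ≤ C) :
    ‖F.p (G.src (m 0)) * x * F.p (G.src (m 0))‖ ≤ C := by
  refine le_of_forall_pos_le_add fun ε hε => ?_
  obtain ⟨x', hx', hd⟩ := Metric.dense_iff.1 hF x (ε / 2) (half_pos hε)
  rw [Metric.mem_ball, dist_eq_norm] at hx'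
  have h1 : ‖F.p (G.src (m 0)) * x' * F.p (G.src (m 0))‖ ≤ C + ε / 2 := by
    refine (isCycleFunction_corner hm χ hd).norm_le hm fun z => ?_
    rw [χ.map_corner]
    calc ‖χ.φ z x'‖ = ‖χ.φ z x + χ.φ z (x' - x)‖ := by rw [← map_add, add_sub_cancel]
      _ ≤ ‖χ.φ z x‖ + ‖χ.φ z (x' - x)‖ := norm_add_le _ _
      _ ≤ C + ε / 2 := add_le_add (hC z) ((χ.norm_le z _).trans hx'.le)
  have h2 : ‖F.p (G.src (m 0)) * (x - x') * F.p (G.src (m 0))‖ ≤ ε / 2 := by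
    have hp := F.norm_p_le_one (G.src (m 0))
    calc _ ≤ ‖F.p (G.src (m 0))‖ * ‖x - x'‖ * ‖F.p (G.src (m 0))‖ :=
          (norm_mul_le _ _).trans (mul_le_mul_of_nonneg_right (norm_mul_le _ _) (norm_nonneg _))
      _ ≤ 1 * ‖x - x'‖ * 1 := by gcongr
      _ ≤ ε / 2 := by
        rw [one_mul, mul_one, norm_sub_rev]
        exact hx'.le
  calc ‖F.p (G.src (m 0)) * x * F.p (G.src (m 0))‖
      = ‖F.p (G.src (m 0)) * x' * F.p (G.src (m 0)) +
          F.p (G.src (m 0)) * (x - x') * F.p (G.src (m 0))‖ := by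
        rw [← add_mul, ← mul_add, add_sub_cancel]
    _ ≤ (C + ε / 2) + ε / 2 := (norm_add_le _ _).trans (add_le_add h1 h2)
    _ = C + ε := by ring

include hm in
-- The functionals are contractive uniformly in z, so continuity passes from the dense subalgebra to
-- uniform limits.
theorem continuous_cornerCharacter (hF : F.Generates) (x : A) : Continuous fun z => χ.φ z x := by
  refine continuous_of_uniform_approx_of_continuous fun U hU => ?_
  obtain ⟨ε, hε, hU⟩ := Metric.mem_uniformity_dist.1 hU
  obtain ⟨x', hx', hd⟩ := Metric.dense_iff.1 hF x ε hε
  refine ⟨fun z => χ.φ z x', ?_, fun z => hU ?_⟩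
  · obtain ⟨f, hf, -, -, hfz⟩ := (isCycleFunction_corner hm χ hd).exists_cfc
    simp_rw [χ.map_corner] at hfz
    simp_rw [hfz]
    fun_prop
  · rw [dist_eq_norm, ← map_sub]
    rw [Metric.mem_ball, dist_comm, dist_eq_norm] at hx'
    exact (χ.norm_le z _).trans_lt hx'

variable (F) in
theorem map_succPow (z : Circle) {a : A} (ha : F.p (G.src (m 0)) * a = a) (n : ℕ) :
    χ.φ z (succPow a n) = χ.φ z a ^ (n + 1) := by
  induction n with
  | zero => rw [zero_add, pow_one]; rfl
  | succ n ih =>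
    rw [succPow]
    nth_rewrite 2 [← ha]
    rw [← mul_assoc, χ.map_mul, ih, ← pow_succ]

include hm χ in
theorem not_isZornRing (hF : F.Generates) : ¬ IsZornRing A := by
  intro h
  set p := F.p (G.src (m 0)) with hp
  set a := F.pathProd m N - p with ha
  have hpp : p * p = p := F.p_mul_self _
  have hpa : p * a = a := by rw [ha, mul_sub, F.p_mul_pathProd, hpp]
  have hap : a * p = a := by rw [ha, sub_mul, F.pathProd_mul_p_zero hm, hpp]
  have hφa (z : Circle) : χ.φ z a = (z : ℂ) ^ N - 1 := by
    rw [ha, map_sub, χ.map_pathProd, χ.map_p]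
  rcases h a with ⟨n, hn⟩ | ⟨b, hb, hb0⟩
  -- At z = exp(iπ/N) one has z^N = -1, so `a` takes the value -2 there and no power of it vanishes.
  · have h1 := map_succPow F χ (Circle.exp (Real.pi / N)) hpa n
    have hN : (N : ℂ) ≠ 0 := by exact_mod_cast hm.pos.ne'
    have h2 : ((Circle.exp (Real.pi / N) : Circle) : ℂ) ^ N = -1 := by
      rw [Circle.coe_exp, ← Complex.exp_nat_mul, ← Complex.exp_pi_mul_I]
      congr 1
      push_cast
      field_simp
    rw [hn, hφa, h2, map_zero] at h1
    exact pow_ne_zero (n + 1) (by norm_num : (-1 - 1 : ℂ) ≠ 0) h1.symm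
  · have hb' : a * b * (a * b) = a * b := hb
    have hpe : p * (a * b) = a * b := by rw [← mul_assoc, hpa]
    -- The idempotent `a * b` need not lie in the corner, but inserting p in its square changes
    -- nothing, so each φ_z still maps it to an idempotent scalar.
    have hee : a * b * p * (a * b) = a * b := by rw [mul_assoc, hpe, hb']
    have hφ (z : Circle) : χ.φ z (a * b) = 0 ∨ χ.φ z (a * b) = 1 := by
      have h1 := χ.map_mul z (a * b) (a * b)
      rw [← hp, hee] at h1
      have h2 : χ.φ z (a * b) * (χ.φ z (a * b) - 1) = 0 := by rw [mul_sub, ← h1, mul_one, sub_self]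
      exact (mul_eq_zero.1 h2).imp_right sub_eq_zero.1
    have hφ1 : χ.φ 1 (a * b) = 0 := by
      rw [← hap, χ.map_mul, hφa]
      simp
    have hφ0 (z : Circle) : χ.φ z (a * b) = 0 := by
      have hc := continuous_cornerCharacter hm χ hF (a * b)
      have hclopen : IsClopen {z | χ.φ z (a * b) = 0} := by
        refine ⟨isClosed_eq hc continuous_const, ?_⟩
        have : {z | χ.φ z (a * b) = 0} = {z | χ.φ z (a * b) ≠ 1} := by
          ext z
          rcases hφ z with h | h <;> simp [h]
        rw [this]
        exact isOpen_ne_fun hc continuous_const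
      exact Set.eq_univ_iff_forall.1 (hclopen.eq_univ ⟨1, hφ1⟩) z
    have h0 : p * (a * b) * p = 0 := norm_le_zero_iff.1
      (norm_corner_le hm χ hF fun z => by rw [hφ0, norm_zero])
    rw [hpe] at h0
    exact hb0 (by rw [← hee, h0, zero_mul])

end CuntzKriegerFamily

end DirectedGraph

namespace DirectedGraph

variable {V : Type u} {E : Type v} {G : DirectedGraph V E} {m : ℕ → E} {N : ℕ}

/-! ### The states at a cycle without exit -/

namespace IsExitlessCycle

variable (hm : G.IsExitlessCycle m N)
include hm

/-- The infinite path that runs through the cycle, from its `k`-th edge on. -/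
def path (k : ℕ) : G.InfinitePath := ⟨fun i => m (k + i), fun i => hm.composable (k + i)⟩

theorem path_period : hm.path N = hm.path 0 := by
  ext i
  simp only [path, zero_add]
  rw [add_comm, hm.periodic]

/-- Without exits, the starting vertex determines every later edge; hence p has rank one on ℓ² of
the infinite paths. -/
theorem eq_path {x : G.InfinitePath} (hx : G.src (x.edge 0) = G.src (m 0)) : x = hm.path 0 := by
  ext i
  simp only [path, zero_add]
  induction i with
  | zero => exact hm.exitless 0 _ hx
  | succ i ih => exact hm.exitless _ _ (by rw [← x.composable, ih, hm.composable])

variable (z : Circle)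

open Classical in
theorem pathFamily_p_apply (g : lp (fun _ : G.InfinitePath => ℂ) 2) :
    (G.pathFamily z).p (G.src (m 0)) g = lp.single 2 (hm.path 0) (g (hm.path 0)) := by
  ext x
  change (InfinitePath.startingAt _).compOp g x = _
  rw [PEquiv.compOp_apply, InfinitePath.startingAt_apply, lp.single_apply]
  by_cases h : G.src (x.edge 0) = G.src (m 0)
  · obtain rfl := hm.eq_path h
    simp [h]
  · have : x ≠ hm.path 0 := by
      rintro rfl
      exact h rfl
    simp [h, this]

open Classical in
theorem pathFamily_s_apply (k : ℕ) (c : ℂ) :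
    (G.pathFamily z).s (m k) (lp.single 2 (hm.path (k + 1)) c) =
      (z : ℂ) • lp.single 2 (hm.path k) c := by
  change (z : ℂ) • (InfinitePath.uncons (m k)).compOp _ = _
  rw [PEquiv.compOp_single (x := hm.path k)]
  rw [InfinitePath.uncons_apply, if_pos (show (hm.path k).edge 0 = m k from rfl)]
  congr 1
  ext i
  exact congrArg m (by rw [add_assoc, add_comm 1])

open Classical in
theorem pathFamily_pathProd_apply (k : ℕ) (c : ℂ) :
    (G.pathFamily z).pathProd m k (lp.single 2 (hm.path k) c) =
      (z : ℂ) ^ k • lp.single 2 (hm.path 0) c := by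
  induction k generalizing c with
  | zero =>
    change (G.pathFamily z).p (G.src (m 0)) _ = _
    rw [hm.pathFamily_p_apply, pow_zero, one_smul]
    simp
  | succ k ih =>
    rw [CuntzKriegerFamily.pathProd_succ, mul_apply_eq_comp, hm.pathFamily_s_apply,
      map_smul, ih, smul_smul, pow_succ']

end IsExitlessCycle

variable (G) in
/-- The representation of `C⋆(G)` on `ℓ²` of the infinite paths, twisted by `z`. -/
noncomputable def pathRep (z : Circle) : G.CStar →⋆ₙₐ[ℂ]
    (lp (fun _ : G.InfinitePath => ℂ) 2 →L[ℂ] lp (fun _ : G.InfinitePath => ℂ) 2) :=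
  (G.existsUnique_lift _ (G.pathFamily z)).choose

theorem pathRep_p (z : Circle) (a : V) :
    G.pathRep z (G.canonicalFamily.p a) = (G.pathFamily z).p a :=
  (G.existsUnique_lift _ (G.pathFamily z)).choose_spec.1.1 a

theorem pathRep_s (z : Circle) (e : E) :
    G.pathRep z (G.canonicalFamily.s e) = (G.pathFamily z).s e :=
  (G.existsUnique_lift _ (G.pathFamily z)).choose_spec.1.2 e

theorem pathRep_pathProd (z : Circle) (k : ℕ) :
    G.pathRep z (G.canonicalFamily.pathProd m k) = (G.pathFamily z).pathProd m k := by
  induction k with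
  | zero => exact pathRep_p z _
  | succ k ih => rw [CuntzKriegerFamily.pathProd_succ, map_mul, ih, pathRep_s]; rfl

open Classical in
/-- The vector states of the path representations at the periodic path. -/
noncomputable def IsExitlessCycle.cornerCharacters (hm : G.IsExitlessCycle m N) :
    G.canonicalFamily.CornerCharacters m N where
  φ z :=
    { toFun := fun x => G.pathRep z x (lp.single 2 (hm.path 0) 1) (hm.path 0)
      map_add' := fun x y => by rw [map_add]; rfl
      map_smul' := fun c x => by rw [map_smul]; rfl }
  norm_le z x := by
    change ‖G.pathRep z x (lp.single 2 (hm.path 0) 1) (hm.path 0)‖ ≤ ‖x‖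
    calc _ ≤ ‖G.pathRep z x (lp.single 2 (hm.path 0) 1)‖ := lp.norm_apply_le_norm (by simp) _ _
      _ ≤ ‖G.pathRep z x‖ * ‖lp.single (E := fun _ => ℂ) 2 (hm.path 0) 1‖ :=
        ContinuousLinearMap.le_opNorm _ _
      _ = ‖G.pathRep z x‖ := by rw [lp.norm_single (by simp), norm_one, mul_one]
      _ ≤ ‖x‖ := NonUnitalStarAlgHom.norm_apply_le _ _
  map_mul z x y := by
    change G.pathRep z _ (lp.single 2 (hm.path 0) 1) (hm.path 0) =
      G.pathRep z x (lp.single 2 (hm.path 0) 1) (hm.path 0) *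
        G.pathRep z y (lp.single 2 (hm.path 0) 1) (hm.path 0)
    rw [map_mul, map_mul, pathRep_p, mul_apply_eq_comp, mul_apply_eq_comp,
      hm.pathFamily_p_apply]
    -- The rank-one p leaves only the coordinate `c` of the inner vector, so the matrix coefficient
    -- factors.
    set c := G.pathRep z y (lp.single 2 (hm.path 0) 1) (hm.path 0)
    have : lp.single (E := fun _ : G.InfinitePath => ℂ) 2 (hm.path 0) c =
        c • lp.single (E := fun _ : G.InfinitePath => ℂ) 2 (hm.path 0) 1 := by
      rw [← lp.single_smul, smul_eq_mul, mul_one]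
    rw [this, map_smul, lp.coeFn_smul, Pi.smul_apply, smul_eq_mul, mul_comm]
  map_star z x := by
    change G.pathRep z _ (lp.single 2 (hm.path 0) 1) (hm.path 0) =
      star (G.pathRep z x (lp.single 2 (hm.path 0) 1) (hm.path 0))
    have key (T : lp (fun _ : G.InfinitePath => ℂ) 2 →L[ℂ] lp (fun _ : G.InfinitePath => ℂ) 2) :
        T (lp.single 2 (hm.path 0) 1) (hm.path 0) =
        inner ℂ (lp.single (E := fun _ : G.InfinitePath => ℂ) 2 (hm.path 0) 1)
          (T (lp.single 2 (hm.path 0) 1)) := by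
      rw [lp.inner_single_left]
      simp
    rw [map_star, key, key, ContinuousLinearMap.star_eq_adjoint,
      ContinuousLinearMap.adjoint_inner_right]
    exact (inner_conj_symm _ _).symm
  map_p z := by
    change G.pathRep z _ (lp.single 2 (hm.path 0) 1) (hm.path 0) = 1
    rw [pathRep_p, hm.pathFamily_p_apply]
    simp
  map_pathProd z := by
    change G.pathRep z _ (lp.single 2 (hm.path 0) 1) (hm.path 0) = _
    -- The periodic path returns to itself after `N` shifts, so its basis vector is an eigenvector
    -- of the cycle.
    rw [pathRep_pathProd, ← hm.path_period, hm.pathFamily_pathProd_apply, hm.path_period]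
    simp

variable (G) in
theorem canonicalFamily_generates : G.canonicalFamily.Generates := by
  rintro ⟨a, ha⟩
  rw [closure_subtype]
  refine closure_mono (fun b hb => ?_) ha
  have hle := NonUnitalStarSubalgebra.le_topologicalClosure (NonUnitalStarAlgebra.adjoin ℂ
    (Set.range G.productP ∪ Set.range G.productS))
  refine ⟨⟨b, hle hb⟩, ?_, rfl⟩
  change _ ∈ NonUnitalStarAlgebra.adjoin ℂ _
  induction hb using NonUnitalStarAlgebra.adjoin_induction with
  | mem x hx =>
    refine NonUnitalStarAlgebra.subset_adjoin ℂ _ ?_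
    rcases hx with ⟨x, rfl⟩ | ⟨e, rfl⟩
    exacts [Or.inl ⟨x, rfl⟩, Or.inr ⟨e, rfl⟩]
  | add x y hx hy ihx ihy => exact add_mem ihx ihy
  | zero => exact zero_mem _
  | mul x y hx hy ihx ihy => exact mul_mem ihx ihy
  | smul r x hx ihx => exact SMulMemClass.smul_mem r ihx
  | star x hx ihx => exact star_mem ihx

/-! ### Simple closed paths without exit -/

theorem IsSimpleClosedPath.isExitlessCycle {n : ℕ} {μ : Fin (n + 1) → E}
    (hμ : G.IsSimpleClosedPath μ) (hex : ¬ ∃ e, G.IsExit μ e) :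
    G.IsExitlessCycle (fun k => μ (Fin.ofNat (n + 1) k)) (n + 1) := by
  have hper (k : ℕ) : μ (Fin.ofNat (n + 1) (k + (n + 1))) = μ (Fin.ofNat (n + 1) k) := by
    congr 1
    ext
    simp
  have hcomp (k : ℕ) : G.rng (μ (Fin.ofNat (n + 1) k)) = G.src (μ (Fin.ofNat (n + 1) (k + 1))) := by
    have hlt : k % (n + 1) < n + 1 := Nat.mod_lt k n.succ_pos
    rcases Nat.lt_succ_iff_lt_or_eq.1 hlt with h | h
    · have h1 : Fin.ofNat (n + 1) k = Fin.castSucc ⟨k % (n + 1), h⟩ := rfl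
      have h2 : Fin.ofNat (n + 1) (k + 1) = Fin.succ ⟨k % (n + 1), h⟩ := by
        ext
        simp only [Fin.val_ofNat, Fin.val_succ]
        rw [← Nat.mod_add_mod, Nat.mod_eq_of_lt (Nat.succ_lt_succ h)]
      rw [h1, h2]
      exact hμ.composable _
    · have h1 : Fin.ofNat (n + 1) k = Fin.last n := by
        ext
        simpa using h
      have h2 : Fin.ofNat (n + 1) (k + 1) = 0 := by
        ext
        have := Nat.succ_mod_succ_eq_zero_iff.2 h
        simpa using this
      rw [h1, h2]
      exact hμ.closed
  have hexit (k : ℕ) (e : E) (he : G.src e = G.src (μ (Fin.ofNat (n + 1) k))) :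
      e = μ (Fin.ofNat (n + 1) k) := by
    by_contra hne
    exact hex ⟨e, _, he, hne⟩
  refine ⟨n.succ_pos, hcomp, hper, hexit, fun i j hij h => ?_⟩
  -- Equal sources force equal edges, hence equal later sources. Simplicity speaks only of the base,
  -- so both positions are advanced by `i * n`, which brings `i` to a multiple of the length `n +
  -- 1`.
  have hl (l : ℕ) :
      G.src (μ (Fin.ofNat (n + 1) (i + l))) = G.src (μ (Fin.ofNat (n + 1) (j + l))) := by
    induction l with
    | zero => exact h
    | succ l ih => rw [← add_assoc, ← add_assoc, ← hcomp, ← hcomp, hexit _ _ ih]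
  have h1 := hl (i * n)
  have h2 : Fin.ofNat (n + 1) (i + i * n) = 0 := by
    ext
    have : i + i * n = i * (n + 1) := by ring
    simp [this]
  rw [h2] at h1
  have h3 : Fin.ofNat (n + 1) (j + i * n) = 0 := by
    by_contra hne
    exact hμ.simple _ hne h1.symm
  have h4 : n + 1 ∣ j + i * n := Nat.dvd_of_mod_eq_zero (by simpa using congrArg Fin.val h3)
  have h5 : j + i * n = (j - i) + i * (n + 1) := by
    rw [mul_add, mul_one]
    omega
  rw [h5] at h4
  exact (Nat.dvd_add_iff_left (Dvd.intro_left i rfl)).2 h4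

end DirectedGraph

theorem proposition3 {V : Type u} {E : Type v} (G : DirectedGraph V E)
    (h : IsZornRing G.CStar) : G.ConditionL := by
  intro n μ hμ
  by_contra hex
  have hm := hμ.isExitlessCycle hex
  exact DirectedGraph.CuntzKriegerFamily.not_isZornRing hm hm.cornerCharacters
    G.canonicalFamily_generates h
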